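/- Let $\mathfrak G=\mathbb Z[i]\subset\mathbb C$ be the ring of Gaussian integers, and let $f:\mathbb C\to\mathfrak G$ assign to each $z$ a Gaussian integer nearest to it (ties being broken by any fixed convention). The *Hurwitz expansion* of $z\in\mathbb C$ is the sequence $a_n=f(z_n)$, where $z_0=z$ and $z_{n+1}=(z_n-f(z_n))^{-1}$, the sequence being terminated at $a_n$ if $f(z_n)=z_n$. Let $S=\{x+iy : |x|<\tfrac12,\ |y|<\tfrac12\}$. A finite block $\beta=(b_1,\dots,b_l)$ of Gaussian integers with $|b_j|>1$ for all $j$ is called *admissible* if the set $S_\beta$ of all $z\in S$ whose Hurwitz expansion satisfies $(a_1,\dots,a_l)=\beta$ has nonempty interior in $\mathbb C$. A complex number $z$ whose real or imaginary part is irrational is called *generic* if every admissible block occurs as a block of consecutive terms in the Hurwitz expansion of $z$. **Corollary 8.8.** Let $\zeta_1,\zeta_2\in\mathbb C$ and suppose that $\zeta_1$ or $\zeta_2$ is generic. Then the set $$\{(a-\zeta_1 b)(a-\zeta_2 b) : a,b\in\mathfrak G\}$$ is dense in $\mathbb C$. -/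

import Mathlib

namespace Hurwitz

/-- A choice function of the Hurwitz (nearest integer) algorithm, i.e. the multivalued nearest
Gaussian integer function together with some fixed tie-breaking convention. -/
def IsNearestChoice (f : ℂ → GaussianInt) : Prop :=
  ∀ (z : ℂ) (γ : GaussianInt), ‖z - (f z : ℂ)‖ ≤ ‖z - (γ : ℂ)‖

open Classical in
/-- The sequence `z₀ = z`, `zₙ₊₁ = (zₙ - f zₙ)⁻¹`, terminated (`none` from then on) after the first
`zₙ` with `f zₙ = zₙ`. -/
noncomputable def iterate (f : ℂ → GaussianInt) (z : ℂ) : ℕ → Option ℂ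
  | 0 => some z
  | n + 1 => (iterate f z n).bind fun w =>
      if (f w : ℂ) = w then none else some (w - (f w : ℂ))⁻¹

/-- The `n`-th partial quotient `aₙ = f zₙ` of `z`; `none` if the expansion stopped before. -/
noncomputable def partialQuotient (f : ℂ → GaussianInt) (z : ℂ) (n : ℕ) : Option GaussianInt :=
  (iterate f z n).map f

/-- The block `β = (b₁, …, b_l)` occurs in the expansion of `z` starting at position `k`. -/
def OccursAt (f : ℂ → GaussianInt) (z : ℂ) (β : List GaussianInt) (k : ℕ) : Prop :=
  ∀ (i : ℕ) (h : i < β.length), partialQuotient f z (k + i) = some β[i]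

/-- The open unit square `S` centred at `0`. -/
def square : Set ℂ := {z | |z.re| < 1 / 2 ∧ |z.im| < 1 / 2}

/-- `S_β`: the points of `S` whose expansion satisfies `(a₁, …, a_l) = β`. -/
def cylinder (f : ℂ → GaussianInt) (β : List GaussianInt) : Set ℂ :=
  {z | z ∈ square ∧ OccursAt f z β 1}

/-- A block is admissible if its entries have absolute value greater than `1` and `S_β` has
nonempty interior. -/
def Admissible (f : ℂ → GaussianInt) (β : List GaussianInt) : Prop :=
  (∀ b ∈ β, 1 < ‖(b : ℂ)‖) ∧ (interior (cylinder f β)).Nonempty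

/-- `z` is generic: it is not rational (real or imaginary part irrational) and every admissible
block occurs in its Hurwitz expansion. -/
def IsGeneric (f : ℂ → GaussianInt) (z : ℂ) : Prop :=
  (Irrational z.re ∨ Irrational z.im) ∧
    ∀ β : List GaussianInt, Admissible f β → ∃ k : ℕ, OccursAt f z β k

end Hurwitz

/-!
Running the Hurwitz algorithm on `ζ₁` replaces the form `(a - ζ₁ b) (a - ζ₂ b)` by equivalent ones,
all of discriminant `(ζ₁ - ζ₂) ^ 2`, the first root being replaced by the successive `zₙ`. A long
run of a single partial quotient `c` drives the second root to the fixed point `ω` of `c`, and the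
partial quotients after the run place the first root near any prescribed `t` of large modulus.
If `ζ₁` is generic, such blocks do occur. The form with roots `t`, `ω` takes the value
`(x - t) (x - ω) (ζ₁ - ζ₂) / (t - ω)` at `(x, 1)`, and for `ζ₁ ≠ ζ₂` any complex number is of this
shape for a large integer `x` and a suitable `t`. If `ζ₁ = ζ₂`, the form is the square of a linear
form whose values are already dense.
-/

namespace Hurwitz

open Filter Topology

variable {f : ℂ → GaussianInt}

/-! ### The unit square and nearest Gaussian integers -/

theorem isOpen_square : IsOpen square :=
  (isOpen_lt Complex.continuous_re.abs continuous_const).inter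
    (isOpen_lt Complex.continuous_im.abs continuous_const)

theorem mem_square_of_norm_lt {z : ℂ} (h : ‖z‖ < 1 / 2) : z ∈ square :=
  ⟨(Complex.abs_re_le_norm z).trans_lt h, (Complex.abs_im_le_norm z).trans_lt h⟩

theorem norm_lt_one_of_mem_square {z : ℂ} (h : z ∈ square) : ‖z‖ < 1 :=
  (Complex.norm_le_abs_re_add_abs_im z).trans_lt (by linarith [h.1, h.2])

theorem abs_lt_abs_sub_intCast {x : ℝ} (hx : |x| < 1 / 2) {m : ℤ} (hm : m ≠ 0) :
    |x| < |x - m| := by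
  have one_le : (1 : ℝ) ≤ |(m : ℝ)| := mod_cast Int.one_le_abs hm
  have := abs_sub_abs_le_abs_sub (m : ℝ) x
  rw [abs_sub_comm] at this
  linarith

theorem sq_le_sub_intCast_sq {x : ℝ} (hx : |x| < 1 / 2) (m : ℤ) : x ^ 2 ≤ (x - m) ^ 2 := by
  rcases eq_or_ne m 0 with rfl | hm
  · simp
  · exact (sq_lt_sq.2 (abs_lt_abs_sub_intCast hx hm)).le

theorem norm_lt_norm_sub_of_mem_square {s : ℂ} (hs : s ∈ square) {d : GaussianInt} (hd : d ≠ 0) :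
    ‖s‖ < ‖s - d‖ := by
  rw [← sq_lt_sq₀ (norm_nonneg _) (norm_nonneg _), Complex.sq_norm, Complex.sq_norm,
    Complex.normSq_apply, Complex.normSq_apply, Complex.sub_re, Complex.sub_im,
    ← GaussianInt.intCast_re, ← GaussianInt.intCast_im]
  simp only [← sq]
  by_cases hre : d.re = 0
  · have him : d.im ≠ 0 := fun him => hd (Zsqrtd.ext hre him)
    exact add_lt_add_of_le_of_lt (sq_le_sub_intCast_sq hs.1 _)
      (sq_lt_sq.2 (abs_lt_abs_sub_intCast hs.2 him))
  · exact add_lt_add_of_lt_of_le (sq_lt_sq.2 (abs_lt_abs_sub_intCast hs.1 hre))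
      (sq_le_sub_intCast_sq hs.2 _)

theorem exists_sq_norm_sub_le (z : ℂ) : ∃ a : GaussianInt, ‖z - a‖ ^ 2 ≤ 1 / 2 := by
  refine ⟨⟨round z.re, round z.im⟩, ?_⟩
  have hre := sq_le_sq.2 ((abs_sub_round z.re).trans (le_abs_self (1 / 2)))
  have him := sq_le_sq.2 ((abs_sub_round z.im).trans (le_abs_self (1 / 2)))
  rw [Complex.sq_norm, Complex.normSq_apply, Complex.sub_re, Complex.sub_im,
    ← GaussianInt.intCast_re, ← GaussianInt.intCast_im]
  linarith

theorem IsNearestChoice.sq_norm_sub_le (hf : IsNearestChoice f) (z : ℂ) :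
    ‖z - f z‖ ^ 2 ≤ 1 / 2 := by
  obtain ⟨a, ha⟩ := exists_sq_norm_sub_le z
  exact (pow_le_pow_left₀ (norm_nonneg _) (hf z a) 2).trans ha

theorem IsNearestChoice.norm_sub_le (hf : IsNearestChoice f) (z : ℂ) : ‖z - f z‖ ≤ 3 / 4 := by
  rw [← sq_le_sq₀ (norm_nonneg _) (by norm_num)]
  linarith [hf.sq_norm_sub_le z]

theorem IsNearestChoice.eq_of_sub_mem_square (hf : IsNearestChoice f) {z : ℂ} {a : GaussianInt}
    (h : z - a ∈ square) : f z = a := by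
  by_contra hne
  have := norm_lt_norm_sub_of_mem_square h (sub_ne_zero.2 hne)
  rw [map_sub, sub_sub_sub_cancel_right] at this
  exact this.not_ge (hf z a)

theorem norm_eq_one_of_ne_zero_of_norm_le_one {a : GaussianInt} (h0 : a ≠ 0)
    (h : ‖(a : ℂ)‖ ≤ 1) : ‖(a : ℂ)‖ = 1 := by
  have one_le : (1 : ℝ) ≤ ‖(a : ℂ)‖ ^ 2 := by
    rw [Complex.sq_norm, ← GaussianInt.intCast_real_norm]
    exact mod_cast GaussianInt.norm_pos.2 h0
  exact le_antisymm h ((one_le_sq_iff₀ (norm_nonneg _)).1 one_le)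

-- If `a` is a unit, then `s` lies closer to `0` than to the Gaussian integer `a⁻¹`.
theorem one_lt_norm_of_inv_sub_mem_square {s : ℂ} {a : GaussianInt} (hs : s ∈ square)
    (hs0 : s ≠ 0) (h : s⁻¹ - a ∈ square) : 1 < ‖(a : ℂ)‖ := by
  by_contra! hle
  have hs1 : ‖s‖ < 1 := norm_lt_one_of_mem_square hs
  have hsa : ‖s⁻¹ - a‖ < 1 := norm_lt_one_of_mem_square h
  rcases eq_or_ne a 0 with rfl | ha
  · rw [map_zero, sub_zero, norm_inv] at hsa
    exact hsa.not_gt ((one_lt_inv₀ (norm_pos_iff.2 hs0)).2 hs1)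
  · have ha1 := norm_eq_one_of_ne_zero_of_norm_le_one ha hle
    have hlt := norm_lt_norm_sub_of_mem_square hs (star_ne_zero.2 ha)
    have hmul : (a : ℂ) * (s - (star a : GaussianInt)) = -(s * (s⁻¹ - a)) := by
      have hstar : (a : ℂ) * (star a : GaussianInt) = 1 := by
        rw [GaussianInt.toComplex_star, Complex.mul_conj, Complex.normSq_eq_norm_sq, ha1]
        norm_num
      rw [mul_sub, hstar, mul_sub, mul_inv_cancel₀ hs0]
      ring
    have hnorm := congrArg norm hmul
    rw [norm_mul, ha1, one_mul, norm_neg, norm_mul] at hnorm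
    have := mul_le_of_le_one_right (norm_nonneg s) hsa.le
    linarith

/-! ### Occurrences of blocks -/

theorem iterate_add (f : ℂ → GaussianInt) (z : ℂ) (k n : ℕ) :
    iterate f z (k + n) = (iterate f z k).bind fun w => iterate f w n := by
  induction n with
  | zero => simp [iterate]
  | succ n ih =>
    rw [← add_assoc, iterate, ih, Option.bind_assoc]
    rfl

theorem iterate_succ_eq_some_iff {z u : ℂ} {n : ℕ} :
    iterate f z (n + 1) = some u ↔
      ∃ w, iterate f z n = some w ∧ w ≠ f w ∧ (w - f w)⁻¹ = u := by
  rw [iterate, Option.bind_eq_some_iff]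
  refine exists_congr fun w => and_congr_right fun _ => ?_
  split_ifs with h
  · simp [h]
  · simp [Ne.symm h]

theorem iterate_one {z : ℂ} (h : z ≠ f z) : iterate f z 1 = some (z - f z)⁻¹ :=
  iterate_succ_eq_some_iff.2 ⟨z, rfl, h, rfl⟩

theorem partialQuotient_eq_some_iff {z : ℂ} {n : ℕ} {a : GaussianInt} :
    partialQuotient f z n = some a ↔ ∃ w, iterate f z n = some w ∧ f w = a :=
  Option.map_eq_some_iff

theorem partialQuotient_add {z w : ℂ} {k : ℕ} (h : iterate f z k = some w) (n : ℕ) :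
    partialQuotient f z (k + n) = partialQuotient f w n := by
  rw [partialQuotient, iterate_add, h]
  rfl

theorem occursAt_add_iff {z w : ℂ} {k : ℕ} (h : iterate f z k = some w) {β : List GaussianInt}
    {n : ℕ} : OccursAt f z β (k + n) ↔ OccursAt f w β n := by
  simp only [OccursAt, add_assoc, partialQuotient_add h]

theorem occursAt_nil (z : ℂ) (k : ℕ) : OccursAt f z [] k :=
  fun _ hi => absurd hi (Nat.not_lt_zero _)

theorem occursAt_cons_iff {z : ℂ} {a : GaussianInt} {β : List GaussianInt} {k : ℕ} :
    OccursAt f z (a :: β) k ↔ partialQuotient f z k = some a ∧ OccursAt f z β (k + 1) := by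
  refine ⟨fun h => ⟨h 0 (Nat.succ_pos _), fun i hi => ?_⟩, fun h i hi => ?_⟩
  · rw [add_assoc, add_comm 1]
    exact h (i + 1) (Nat.succ_lt_succ hi)
  · cases i with
    | zero => exact h.1
    | succ i =>
      simpa only [add_assoc, add_comm 1, List.getElem_cons_succ] using
        h.2 i (Nat.lt_of_succ_lt_succ hi)

theorem occursAt_append_iff {z : ℂ} {β γ : List GaussianInt} {k : ℕ} :
    OccursAt f z (β ++ γ) k ↔ OccursAt f z β k ∧ OccursAt f z γ (k + β.length) := by
  induction β generalizing k with
  | nil => simp [occursAt_nil]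
  | cons a β ih =>
    rw [List.cons_append, occursAt_cons_iff, ih, occursAt_cons_iff, and_assoc, List.length_cons,
      add_assoc, add_comm 1]

theorem OccursAt.exists_iterate {z : ℂ} {b : GaussianInt} {β : List GaussianInt} {k : ℕ}
    (h : OccursAt f z (b :: β) k) :
    ∃ w, iterate f z k = some w ∧ OccursAt f w (b :: β) 0 := by
  obtain ⟨w, hw, -⟩ := partialQuotient_eq_some_iff.1 (occursAt_cons_iff.1 h).1
  exact ⟨w, hw, (occursAt_add_iff hw).1 h⟩

theorem OccursAt.exists_iterate_iterate {z : ℂ} {a b : GaussianInt} {β γ : List GaussianInt}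
    {k : ℕ} (h : OccursAt f z (a :: β ++ b :: γ) k) :
    ∃ y w, iterate f z k = some y ∧ OccursAt f y (a :: β) 0 ∧
      iterate f y (β.length + 1) = some w ∧ OccursAt f w (b :: γ) 0 := by
  rw [List.cons_append] at h
  obtain ⟨y, hy, hyocc⟩ := h.exists_iterate
  rw [← List.cons_append, occursAt_append_iff, zero_add] at hyocc
  obtain ⟨w, hw, hwocc⟩ := hyocc.2.exists_iterate
  exact ⟨y, w, hy, hyocc.1, hw, hwocc⟩

theorem OccursAt.head_eq {z : ℂ} {a : GaussianInt} {β : List GaussianInt}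
    (h : OccursAt f z (a :: β) 0) : f z = a :=
  Option.some_injective _ (occursAt_cons_iff.1 h).1

theorem OccursAt.tail {z : ℂ} {a b : GaussianInt} {β : List GaussianInt}
    (h : OccursAt f z (a :: b :: β) 0) :
    z ≠ a ∧ OccursAt f (z - a)⁻¹ (b :: β) 0 := by
  obtain rfl := h.head_eq
  obtain ⟨w, hw, hocc⟩ := (occursAt_cons_iff.1 h).2.exists_iterate
  obtain ⟨_, ⟨rfl⟩, hne, rfl⟩ := iterate_succ_eq_some_iff.1 hw
  exact ⟨hne, hocc⟩

theorem OccursAt.norm_sub_head_le (hf : IsNearestChoice f) {z : ℂ} {a : GaussianInt}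
    {β : List GaussianInt} (h : OccursAt f z (a :: β) 0) : ‖z - a‖ ≤ 3 / 4 :=
  h.head_eq ▸ hf.norm_sub_le z

theorem occursAt_cons_of_inv {z : ℂ} {a : GaussianInt} {β : List GaussianInt} (ha : f z = a)
    (hne : z ≠ a) (h : OccursAt f (z - a)⁻¹ β 0) : OccursAt f z (a :: β) 0 := by
  subst ha
  exact occursAt_cons_iff.2 ⟨rfl, (occursAt_add_iff (iterate_one hne) (n := 0)).2 h⟩

theorem norm_sub_le_of_occursAt (hf : IsNearestChoice f) {β : List GaussianInt} {b : GaussianInt}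
    {z w : ℂ} (hz : OccursAt f z (b :: β) 0) (hw : OccursAt f w (b :: β) 0) :
    ‖z - w‖ ≤ 2 * (3 / 4) ^ β.length := by
  induction β generalizing b z w with
  | nil =>
    calc ‖z - w‖ = ‖(z - b) - (w - b)‖ := by rw [sub_sub_sub_cancel_right]
      _ ≤ ‖z - b‖ + ‖w - b‖ := norm_sub_le _ _
      _ ≤ 2 * (3 / 4) ^ ([] : List GaussianInt).length := by
        rw [List.length_nil, pow_zero]
        linarith [hz.norm_sub_head_le hf, hw.norm_sub_head_le hf]
  | cons c β ih =>
    obtain ⟨hz0, hz'⟩ := hz.tail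
    obtain ⟨hw0, hw'⟩ := hw.tail
    have htail := ih hz' hw'
    have hsub : z - w = -((z - b) * (w - b) * ((z - b)⁻¹ - (w - b)⁻¹)) := by
      field_simp [sub_ne_zero.2 hz0, sub_ne_zero.2 hw0]
      ring
    calc ‖z - w‖ = ‖z - b‖ * ‖w - b‖ * ‖(z - b)⁻¹ - (w - b)⁻¹‖ := by
          rw [hsub, norm_neg, norm_mul, norm_mul]
      _ ≤ 3 / 4 * 1 * (2 * (3 / 4) ^ β.length) := by
          gcongr
          · exact hz.norm_sub_head_le hf
          · linarith [hw.norm_sub_head_le hf]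
      _ = 2 * (3 / 4) ^ (c :: β).length := by
          rw [List.length_cons]
          ring

/-! ### Open cylinders -/

/-- The points whose expansion starts with the given block, from position `0` on, in such a way
that every iterate `zₙ` along it differs from the partial quotient `aₙ` by a nonzero element of the
open unit square. Unlike `cylinder`, these sets do not depend on how ties are broken. -/
def openCylinder : List GaussianInt → Set ℂ
  | [] => Set.univ
  | a :: β => {z | z - (a : ℂ) ∈ square \ {0} ∧ (z - (a : ℂ))⁻¹ ∈ openCylinder β}

theorem isOpen_openCylinder (β : List GaussianInt) : IsOpen (openCylinder β) := by
  induction β with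
  | nil => exact isOpen_univ
  | cons a β ih =>
    have hsub : Continuous fun z : ℂ => z - a := by fun_prop
    exact (hsub.continuousOn.inv₀ fun z hz => hz.2).isOpen_inter_preimage
      ((isOpen_square.sdiff isClosed_singleton).preimage hsub) ih

theorem occursAt_of_mem_openCylinder (hf : IsNearestChoice f) {β : List GaussianInt} {z : ℂ}
    (h : z ∈ openCylinder β) : OccursAt f z β 0 := by
  induction β generalizing z with
  | nil => exact occursAt_nil z 0
  | cons a β ih =>
    obtain ⟨⟨hsq, hne⟩, htail⟩ := h
    exact occursAt_cons_of_inv (hf.eq_of_sub_mem_square hsq) (sub_ne_zero.1 hne) (ih htail)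

theorem one_lt_norm_of_mem_openCylinder_cons {a : GaussianInt} {β : List GaussianInt} {s : ℂ}
    (h : s ∈ openCylinder (a :: β)) : ∀ b ∈ β, 1 < ‖(b : ℂ)‖ := by
  induction β generalizing a s with
  | nil => simp
  | cons b β ih =>
    obtain ⟨⟨hsq, hne⟩, htail⟩ := h
    exact List.forall_mem_cons.2 ⟨one_lt_norm_of_inv_sub_mem_square hsq hne htail.1.1, ih htail⟩

theorem openCylinder_zero_cons_subset_cylinder (hf : IsNearestChoice f) (β : List GaussianInt) :
    openCylinder (0 :: β) ⊆ cylinder f β := fun s hs =>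
  ⟨by simpa using hs.1.1, (occursAt_cons_iff.1 (occursAt_of_mem_openCylinder hf hs)).2⟩

theorem admissible_of_mem_openCylinder (hf : IsNearestChoice f) {β : List GaussianInt} {s : ℂ}
    (h : s ∈ openCylinder (0 :: β)) : Admissible f β :=
  ⟨one_lt_norm_of_mem_openCylinder_cons h, s,
    interior_maximal (openCylinder_zero_cons_subset_cylinder hf β) (isOpen_openCylinder _) h⟩

theorem dense_inv_preimage {K : Type*} [GroupWithZero K] [TopologicalSpace K] [T1Space K]
    [ContinuousInv₀ K] [(𝓝[≠] (0 : K)).NeBot] {U : Set K} (hU : Dense U) :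
    Dense (Inv.inv ⁻¹' U) := by
  intro z
  refine mem_closure_iff.2 fun O hO hz => ?_
  have hO' : IsOpen ({0}ᶜ ∩ Inv.inv ⁻¹' (O \ {0})) :=
    continuousOn_inv₀.isOpen_inter_preimage isOpen_compl_singleton
      (hO.sdiff isClosed_singleton)
  obtain ⟨w, hw, hw0⟩ := (dense_compl_singleton (0 : K)).inter_open_nonempty O hO ⟨z, hz⟩
  obtain ⟨u, hu, huU⟩ := hU.inter_open_nonempty _ hO' ⟨w⁻¹, by simpa using ⟨hw0, hw, hw0⟩⟩
  exact ⟨u⁻¹, hu.2.1, by simpa using huU⟩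

theorem abs_sub_round_lt_of_irrational {x : ℝ} (hx : Irrational x) : |x - round x| < 1 / 2 := by
  refine (abs_sub_round x).lt_of_ne fun h => ?_
  rcases eq_or_eq_neg_of_abs_eq h with h | h
  · exact hx ⟨round x + 1 / 2, by push_cast; linarith⟩
  · exact hx ⟨round x - 1 / 2, by push_cast; linarith⟩

theorem dense_exists_sub_mem_square :
    Dense {z : ℂ | ∃ a : GaussianInt, z - a ∈ square \ {0}} := by
  have hirr : Dense ({x : ℝ | Irrational x} ×ℂ {x : ℝ | Irrational x}) := by
    rw [dense_iff_closure_eq, Complex.closure_reProdIm, dense_irrational.closure_eq]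
    exact Set.inter_self _
  refine hirr.mono fun z hz => ⟨⟨round z.re, round z.im⟩, ⟨?_, ?_⟩, ?_⟩
  · simpa using abs_sub_round_lt_of_irrational hz.1
  · simpa using abs_sub_round_lt_of_irrational hz.2
  · intro h
    refine hz.1.ne_int (round z.re) ?_
    simpa [sub_eq_zero] using congrArg Complex.re h

theorem dense_exists_mem_openCylinder (n : ℕ) :
    Dense {z | ∃ β : List GaussianInt, β.length = n ∧ z ∈ openCylinder β} := by
  induction n with
  | zero => exact dense_univ.mono fun z hz => ⟨[], rfl, hz⟩
  | succ n ih =>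
    refine dense_iff_inter_open.2 fun W hW hne => ?_
    obtain ⟨z, hz, a, hza⟩ := dense_exists_sub_mem_square.inter_open_nonempty W hW hne
    have hopen : IsOpen {w | w + (a : ℂ) ∈ W ∧ w ∈ square \ {0}} :=
      (hW.preimage (continuous_add_const _)).inter (isOpen_square.sdiff isClosed_singleton)
    obtain ⟨w, ⟨hwW, hwsq⟩, β, hβ, hwβ⟩ :=
      (dense_inv_preimage ih).inter_open_nonempty _ hopen ⟨z - a, by simpa using hz, hza⟩
    exact ⟨w + a, hwW, a :: β, congrArg Nat.succ hβ, by simpa [openCylinder] using ⟨hwsq, hwβ⟩⟩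

theorem inv_mem_openCylinder_zero_cons {β : List GaussianInt} {z : ℂ} (h : z ∈ openCylinder β)
    (hz : 2 < ‖z‖) : z⁻¹ ∈ openCylinder (0 :: β) := by
  have hz0 : z ≠ 0 := norm_pos_iff.1 (by linarith)
  have hsq : z⁻¹ ∈ square := mem_square_of_norm_lt <| by
    rw [norm_inv, one_div]
    exact inv_strictAnti₀ two_pos hz
  simpa [openCylinder, hz0] using ⟨hsq, h⟩

theorem add_mem_openCylinder_cons {β : List GaussianInt} {s : ℂ} (h : s ∈ openCylinder (0 :: β))
    (c : GaussianInt) : c + s ∈ openCylinder (c :: β) := by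
  simpa [openCylinder] using h

theorem exists_mem_openCylinder_replicate_append {β : List GaussianInt} {z : ℂ} {c : GaussianInt}
    (hc : 3 ≤ ‖(c : ℂ)‖) (h : z ∈ openCylinder β) (hz : 2 < ‖z‖) (m : ℕ) :
    ∃ w : ℂ, 2 < ‖w‖ ∧ w ∈ openCylinder (List.replicate m c ++ β) := by
  induction m with
  | zero => exact ⟨z, hz, h⟩
  | succ m ih =>
    obtain ⟨w, hw, hmem⟩ := ih
    refine ⟨c + w⁻¹, ?_, add_mem_openCylinder_cons (inv_mem_openCylinder_zero_cons hmem hw) c⟩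
    have hinv : ‖w⁻¹‖ < 1 := by
      rw [norm_inv]
      exact inv_lt_one_of_one_lt₀ (by linarith)
    linarith [norm_sub_le_norm_add (c : ℂ) w⁻¹]

theorem admissible_replicate_append (hf : IsNearestChoice f) {β : List GaussianInt} {z : ℂ}
    {c : GaussianInt} (hc : 3 ≤ ‖(c : ℂ)‖) (h : z ∈ openCylinder β) (hz : 2 < ‖z‖) (m : ℕ) :
    Admissible f (List.replicate m c ++ β) := by
  obtain ⟨w, hw, hmem⟩ := exists_mem_openCylinder_replicate_append hc h hz m
  exact admissible_of_mem_openCylinder hf (inv_mem_openCylinder_zero_cons hmem hw)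

/-! ### Bases adapted to the expansion -/

/-- The lattice of pairs of conjugate values `(a - ζ₁ b, a - ζ₂ b)`; the form
`(a - ζ₁ b) (a - ζ₂ b)` is the product of the two coordinates. -/
def conjugateLattice (ζ₁ ζ₂ : ℂ) : Set (ℂ × ℂ) :=
  Set.range fun p : GaussianInt × GaussianInt => ((p.1 : ℂ) - ζ₁ * p.2, (p.1 : ℂ) - ζ₂ * p.2)

theorem smul_add_smul_mem_conjugateLattice {ζ₁ ζ₂ : ℂ} {u v : ℂ × ℂ}
    (hu : u ∈ conjugateLattice ζ₁ ζ₂) (hv : v ∈ conjugateLattice ζ₁ ζ₂) (x y : GaussianInt) :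
    (x : ℂ) • u + (y : ℂ) • v ∈ conjugateLattice ζ₁ ζ₂ := by
  obtain ⟨⟨a, b⟩, rfl⟩ := hu
  obtain ⟨⟨a', b'⟩, rfl⟩ := hv
  refine ⟨(x * a + y * a', x * b + y * b'), ?_⟩
  ext <;> simp <;> ring

/-- A pair `u`, `v` of lattice vectors belonging to the iterate `z` of `ζ₁`; by `det_eq` it is a
basis of the lattice if `ζ₁ ≠ ζ₂`. Up to the factor `u.1`, the first coordinate of `x u - y v` is
`x - z y`, and the form takes the value `(x - z y) (μ x - ν y)` there, with `μ = u.1 * u.2` and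
`ν = u.1 * v.2`. In these terms `det_eq` says that `μ z - ν = ζ₁ - ζ₂`. -/
structure IsAdaptedBasis (ζ₁ ζ₂ z : ℂ) (u v : ℂ × ℂ) : Prop where
  left_mem : u ∈ conjugateLattice ζ₁ ζ₂
  right_mem : v ∈ conjugateLattice ζ₁ ζ₂
  fst_ne_zero : u.1 ≠ 0
  fst_eq : v.1 = z * u.1
  det_eq : u.2 * v.1 - u.1 * v.2 = ζ₁ - ζ₂

theorem isAdaptedBasis_one (ζ₁ ζ₂ : ℂ) : IsAdaptedBasis ζ₁ ζ₂ ζ₁ (1, 1) (ζ₁, ζ₂) where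
  left_mem := ⟨(1, 0), by simp⟩
  right_mem := ⟨(0, -1), by simp⟩
  fst_ne_zero := one_ne_zero
  fst_eq := (mul_one ζ₁).symm
  det_eq := by simp

namespace IsAdaptedBasis

variable {ζ₁ ζ₂ z : ℂ} {u v : ℂ × ℂ}

-- The factor `I` makes the change of basis unimodular, so that `det_eq` holds without a sign.
theorem step (h : IsAdaptedBasis ζ₁ ζ₂ z u v) {a : GaussianInt} (ha : z ≠ a) :
    IsAdaptedBasis ζ₁ ζ₂ (z - a)⁻¹ (Complex.I • (v - (a : ℂ) • u)) (Complex.I • u) where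
  left_mem := by
    convert smul_add_smul_mem_conjugateLattice h.left_mem h.right_mem (-(⟨0, 1⟩ * a)) ⟨0, 1⟩
      using 1
    simp only [map_neg, map_mul, GaussianInt.toComplex_def', smul_sub, smul_smul, neg_smul]
    simp [sub_eq_neg_add]
  right_mem := by
    convert smul_add_smul_mem_conjugateLattice h.left_mem h.left_mem ⟨0, 1⟩ 0 using 1
    simp [GaussianInt.toComplex_def']
  fst_ne_zero := by
    have : v.1 - a * u.1 = (z - a) * u.1 := by rw [h.fst_eq, sub_mul]
    simp [this, sub_ne_zero.2 ha, h.fst_ne_zero]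
  fst_eq := by
    simp only [Prod.smul_fst, Prod.fst_sub, smul_eq_mul, h.fst_eq]
    field_simp [sub_ne_zero.2 ha]
  det_eq := by
    simp only [Prod.smul_fst, Prod.smul_snd, Prod.fst_sub, Prod.snd_sub, smul_eq_mul]
    linear_combination (u.1 * v.2 - u.2 * v.1) * Complex.I_sq + h.det_eq

theorem fst_mul_snd_step (h : IsAdaptedBasis ζ₁ ζ₂ z u v) (a : ℂ) :
    (Complex.I • (v - a • u)).1 * (Complex.I • (v - a • u)).2 =
      (z - a) * (ζ₁ - ζ₂) - (z - a) ^ 2 * (u.1 * u.2) := by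
  simp only [Prod.smul_fst, Prod.smul_snd, Prod.fst_sub, Prod.snd_sub, smul_eq_mul, ← h.det_eq,
    h.fst_eq]
  linear_combination ((z - a) * u.1 * (v.2 - a * u.2)) * Complex.I_sq

theorem norm_fst_step (h : IsAdaptedBasis ζ₁ ζ₂ z u v) (a : ℂ) :
    ‖(Complex.I • (v - a • u)).1‖ = ‖z - a‖ * ‖u.1‖ := by
  rw [← norm_mul, sub_mul, ← h.fst_eq]
  simp

theorem exists_of_iterate (hf : IsNearestChoice f) (ζ₁ ζ₂ : ℂ) {n : ℕ}
    (hz : iterate f ζ₁ n = some z) :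
    ∃ u v, IsAdaptedBasis ζ₁ ζ₂ z u v ∧ ‖u.1‖ ≤ (3 / 4) ^ n ∧
      ‖u.1 * u.2‖ ≤ 3 / 2 * ‖ζ₁ - ζ₂‖ + 1 := by
  induction n generalizing z with
  | zero =>
    obtain rfl : ζ₁ = z := Option.some_injective _ hz
    refine ⟨_, _, isAdaptedBasis_one ζ₁ ζ₂, by simp, ?_⟩
    rw [mul_one, norm_one]
    linarith [norm_nonneg (ζ₁ - ζ₂)]
  | succ n ih =>
    obtain ⟨w, hw, hne, rfl⟩ := iterate_succ_eq_some_iff.1 hz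
    obtain ⟨u, v, h, hu, hμ⟩ := ih hw
    refine ⟨_, _, h.step hne, ?_, ?_⟩
    · rw [h.norm_fst_step, pow_succ']
      gcongr
      exact hf.norm_sub_le w
    · calc _ = ‖(w - f w) * (ζ₁ - ζ₂) - (w - f w) ^ 2 * (u.1 * u.2)‖ := by
            rw [h.fst_mul_snd_step]
        _ ≤ ‖w - f w‖ * ‖ζ₁ - ζ₂‖ + ‖w - f w‖ ^ 2 * ‖u.1 * u.2‖ := by
            rw [← norm_mul, ← norm_pow, ← norm_mul]
            exact norm_sub_le _ _
        _ ≤ 3 / 4 * ‖ζ₁ - ζ₂‖ + 1 / 2 * (3 / 2 * ‖ζ₁ - ζ₂‖ + 1) := by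
            gcongr
            · exact hf.norm_sub_le w
            · exact hf.sq_norm_sub_le w
        _ ≤ 3 / 2 * ‖ζ₁ - ζ₂‖ + 1 := by linarith

-- In terms of the second root `ν / μ`, the quantity being contracted is `ν - ω * μ`.
theorem exists_of_replicate (hf : IsNearestChoice f) {c : GaussianInt} {ω : ℂ}
    (hω : ω ^ 2 = c * ω + 1) (hω1 : ‖ω‖ ≤ 1) (h : IsAdaptedBasis ζ₁ ζ₂ z u v) {m : ℕ} {w : ℂ}
    (hocc : OccursAt f z (List.replicate m c) 0) (hw : iterate f z m = some w) :
    ∃ u' v', IsAdaptedBasis ζ₁ ζ₂ w u' v' ∧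
      ‖u'.1 * u'.2 * (w - ω) - (ζ₁ - ζ₂)‖ ≤
        (3 / 4) ^ m * ‖u.1 * u.2 * (z - ω) - (ζ₁ - ζ₂)‖ := by
  induction m generalizing w with
  | zero =>
    obtain rfl : z = w := Option.some_injective _ hw
    exact ⟨u, v, h, by simp⟩
  | succ m ih =>
    obtain ⟨y, hy, hne, rfl⟩ := iterate_succ_eq_some_iff.1 hw
    rw [List.replicate_succ', occursAt_append_iff, List.length_replicate, zero_add] at hocc
    obtain ⟨u', v', h', hle⟩ := ih hocc.1 hy
    obtain rfl : f y = c :=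
      ((occursAt_add_iff hy (n := 0)).1 hocc.2).head_eq
    refine ⟨_, _, h'.step hne, ?_⟩
    have hcontract : ((y - f y) * (ζ₁ - ζ₂) - (y - f y) ^ 2 * (u'.1 * u'.2)) *
          ((y - f y)⁻¹ - ω) - (ζ₁ - ζ₂) =
        (y - f y) * ω * (u'.1 * u'.2 * (y - ω) - (ζ₁ - ζ₂)) := by
      have := sub_ne_zero.2 hne
      field_simp
      linear_combination (u'.1 * u'.2 * (y - f y)) * hω
    rw [h'.fst_mul_snd_step, hcontract, norm_mul, norm_mul, pow_succ']
    calc _ ≤ 3 / 4 * 1 * ((3 / 4) ^ m * ‖u.1 * u.2 * (z - ω) - (ζ₁ - ζ₂)‖) := by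
          gcongr
          exact hf.norm_sub_le y
      _ = _ := by ring

theorem mem_image_mul (h : IsAdaptedBasis ζ₁ ζ₂ z u v) (x : GaussianInt) :
    (x - z) * ((x - z) * (u.1 * u.2) + (ζ₁ - ζ₂)) ∈
      (fun p : ℂ × ℂ => p.1 * p.2) '' conjugateLattice ζ₁ ζ₂ := by
  refine ⟨_, smul_add_smul_mem_conjugateLattice h.left_mem h.right_mem x (-1), ?_⟩
  simp only [map_neg, map_one, Prod.fst_add, Prod.snd_add, Prod.smul_fst, Prod.smul_snd,
    smul_eq_mul, ← h.det_eq, h.fst_eq]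
  ring

end IsAdaptedBasis

/-! ### Density -/

-- The two roots of `X ^ 2 - c X - 1` have product `-1`.
theorem exists_fixedPoint_norm_le_one (c : ℂ) : ∃ ω : ℂ, ω ^ 2 = c * ω + 1 ∧ ‖ω‖ ≤ 1 := by
  obtain ⟨s, hs⟩ := IsAlgClosed.exists_pow_nat_eq (c ^ 2 + 4) two_pos
  have hprod : ‖(c + s) / 2‖ * ‖(c - s) / 2‖ = 1 := by
    rw [← norm_mul, show (c + s) / 2 * ((c - s) / 2) = -1 by linear_combination -hs / 4, norm_neg,
      norm_one]
  rcases le_total ‖(c + s) / 2‖ 1 with h | h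
  · exact ⟨(c + s) / 2, by linear_combination hs / 4, h⟩
  · exact ⟨(c - s) / 2, by linear_combination hs / 4,
      (le_mul_of_one_le_left (norm_nonneg _) h).trans_eq hprod⟩

theorem IsNearestChoice.norm_mul_sub_sub_le (hf : IsNearestChoice f) {z ω μ : ℂ} {M : ℝ}
    (hω1 : ‖ω‖ ≤ 1) (hμ : ‖μ‖ ≤ M) (D : ℂ) :
    ‖μ * (z - ω) - D‖ ≤ M * (‖(f z : ℂ)‖ + 2) + ‖D‖ := by
  have hM : 0 ≤ M := (norm_nonneg μ).trans hμ
  have hz : ‖z - ω‖ ≤ ‖(f z : ℂ)‖ + 2 := by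
    linarith [_root_.norm_sub_le z ω, norm_le_norm_sub_add z (f z : ℂ), hf.norm_sub_le z]
  calc ‖μ * (z - ω) - D‖ ≤ ‖μ‖ * ‖z - ω‖ + ‖D‖ := by
        rw [← norm_mul]
        exact _root_.norm_sub_le _ _
    _ ≤ M * (‖(f z : ℂ)‖ + 2) + ‖D‖ := by gcongr

namespace IsGeneric

variable {ζ₁ : ℂ}

theorem exists_isAdaptedBasis_near (hf : IsNearestChoice f) (hζ : IsGeneric f ζ₁) (ζ₂ : ℂ)
    {t ω : ℂ} {c : GaussianInt} (hc : 3 ≤ ‖(c : ℂ)‖) (hω : ω ^ 2 = c * ω + 1) (hω1 : ‖ω‖ ≤ 1)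
    (ht : 2 < ‖t‖) (n : ℕ) :
    ∃ z u v, IsAdaptedBasis ζ₁ ζ₂ z u v ∧ ‖z - t‖ ≤ 3 * (3 / 4) ^ n ∧
      ‖u.1 * u.2 * (z - ω) - (ζ₁ - ζ₂)‖ ≤
        (3 / 4) ^ n * ((3 / 2 * ‖ζ₁ - ζ₂‖ + 1) * (‖(c : ℂ)‖ + 2) + ‖ζ₁ - ζ₂‖) := by
  have hopen : IsOpen (Metric.ball t ((3 / 4) ^ n) ∩ {z : ℂ | 2 < ‖z‖}) :=
    Metric.isOpen_ball.inter (isOpen_lt continuous_const continuous_norm)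
  obtain ⟨s, ⟨hst, hs⟩, γ, hlen, hsγ⟩ :=
    (dense_exists_mem_openCylinder (n + 1)).inter_open_nonempty _ hopen
      ⟨t, Metric.mem_ball_self (by positivity), ht⟩
  obtain ⟨b, β, rfl⟩ := List.exists_cons_of_length_eq_add_one hlen
  obtain ⟨k, hk⟩ := hζ.2 _ (admissible_replicate_append hf hc hsγ hs (n + 1))
  obtain ⟨y, z, hy, hyocc, hz, hzocc⟩ := hk.exists_iterate_iterate
  obtain ⟨u, v, huv, -, hμ⟩ := IsAdaptedBasis.exists_of_iterate hf ζ₁ ζ₂ hy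
  obtain rfl : f y = c := hyocc.head_eq
  rw [List.length_replicate] at hz
  obtain ⟨u', v', huv', hcontract⟩ := huv.exists_of_replicate (m := n + 1) hf hω hω1 hyocc hz
  refine ⟨z, u', v', huv', ?_, hcontract.trans ?_⟩
  · have hzs := norm_sub_le_of_occursAt hf hzocc (occursAt_of_mem_openCylinder hf hsγ)
    rw [Nat.succ_injective hlen] at hzs
    linarith [norm_sub_le_norm_sub_add_norm_sub z s t, mem_ball_iff_norm.1 hst]
  · exact mul_le_mul (pow_le_pow_of_le_one (by norm_num) (by norm_num) n.le_succ)
      (hf.norm_mul_sub_sub_le hω1 hμ _) (norm_nonneg _) (by positivity)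

theorem mem_closure_image_mul (hf : IsNearestChoice f) (hζ : IsGeneric f ζ₁) (ζ₂ : ℂ) {t ω : ℂ}
    {c : GaussianInt} (hc : 3 ≤ ‖(c : ℂ)‖) (hω : ω ^ 2 = c * ω + 1) (hω1 : ‖ω‖ ≤ 1)
    (ht : 2 < ‖t‖) (x : GaussianInt) :
    (x - t) * (x - ω) * ((ζ₁ - ζ₂) / (t - ω)) ∈
      closure ((fun p : ℂ × ℂ => p.1 * p.2) '' conjugateLattice ζ₁ ζ₂) := by
  choose z u v huv hz hμ using hζ.exists_isAdaptedBasis_near hf ζ₂ hc hω hω1 ht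
  have hpow : Tendsto (fun n : ℕ => (3 / 4 : ℝ) ^ n) atTop (𝓝 0) :=
    tendsto_pow_atTop_nhds_zero_of_lt_one (by norm_num) (by norm_num)
  have hz_lim : Tendsto z atTop (𝓝 t) :=
    tendsto_iff_norm_sub_tendsto_zero.2 <|
      squeeze_zero (fun _ => norm_nonneg _) hz (by simpa using hpow.const_mul 3)
  have hzω_lim : Tendsto (fun n => z n - ω) atTop (𝓝 (t - ω)) := hz_lim.sub_const ω
  have htω : t - ω ≠ 0 := by
    rintro h
    rw [sub_eq_zero.1 h] at ht
    linarith
  have hμ_lim : Tendsto (fun n => (u n).1 * (u n).2) atTop (𝓝 ((ζ₁ - ζ₂) / (t - ω))) := by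
    have hmul : Tendsto (fun n => (u n).1 * (u n).2 * (z n - ω)) atTop (𝓝 (ζ₁ - ζ₂)) :=
      tendsto_iff_norm_sub_tendsto_zero.2 <|
        squeeze_zero (fun _ => norm_nonneg _) hμ (by simpa using hpow.mul_const _)
    refine (hmul.div hzω_lim htω).congr' ?_
    filter_upwards [hzω_lim.eventually_ne htω] with n hn
    exact mul_div_cancel_right₀ _ hn
  have hxz_lim : Tendsto (fun n => x - z n) atTop (𝓝 (x - t)) := hz_lim.const_sub _
  have hvalue : (x - t) * (x - ω) * ((ζ₁ - ζ₂) / (t - ω)) =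
      (x - t) * ((x - t) * ((ζ₁ - ζ₂) / (t - ω)) + (ζ₁ - ζ₂)) := by
    field_simp
    ring
  rw [hvalue]
  exact mem_closure_of_tendsto (hxz_lim.mul ((hxz_lim.mul hμ_lim).add_const _))
    (Eventually.of_forall fun n => (huv n).mem_image_mul x)

end IsGeneric

theorem exists_nat_and_root_of_value {D : ℂ} (hD : D ≠ 0) (ω v : ℂ) :
    ∃ (x : ℕ) (t : ℂ), 2 < ‖t‖ ∧ (x - t) * (x - ω) * (D / (t - ω)) = v := by
  obtain ⟨x, hx⟩ := exists_nat_gt (‖ω‖ + (2 * (2 + ‖ω‖) + ‖v‖ / ‖D‖))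
  set s : ℂ := x - ω with hs
  have hnorm : 2 * (2 + ‖ω‖) + ‖v‖ / ‖D‖ < ‖s‖ := by
    have := norm_sub_norm_le (x : ℂ) ω
    rw [Complex.norm_natCast] at this
    linarith
  have hDpos : 0 < ‖D‖ := norm_pos_iff.2 hD
  have hvs : ‖v‖ < ‖s‖ * ‖D‖ := (div_lt_iff₀ hDpos).1 (by linarith [norm_nonneg ω])
  have hspos : 0 < ‖s‖ := pos_of_mul_pos_left ((norm_nonneg v).trans_lt hvs) hDpos.le
  have hden : v + s * D ≠ 0 := fun h => by
    rw [eq_neg_of_add_eq_zero_left h, norm_neg, norm_mul] at hvs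
    exact hvs.false
  have hden_le : ‖v + s * D‖ ≤ 2 * (‖s‖ * ‖D‖) := by
    linarith [norm_add_le v (s * D), norm_mul s D]
  have hquot : 2 + ‖ω‖ < ‖s ^ 2 * D / (v + s * D)‖ := by
    rw [norm_div, norm_mul, norm_pow, lt_div_iff₀ (norm_pos_iff.2 hden)]
    have hv0 : 0 ≤ ‖v‖ / ‖D‖ := by positivity
    calc (2 + ‖ω‖) * ‖v + s * D‖ ≤ (2 + ‖ω‖) * (2 * (‖s‖ * ‖D‖)) := by gcongr
      _ = 2 * (2 + ‖ω‖) * (‖s‖ * ‖D‖) := by ring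
      _ < ‖s‖ * (‖s‖ * ‖D‖) := by
        gcongr
        linarith
      _ = ‖s‖ ^ 2 * ‖D‖ := by ring
  refine ⟨x, ω + s ^ 2 * D / (v + s * D), ?_, ?_⟩
  · rw [add_comm ω]
    linarith [norm_sub_le_norm_add (s ^ 2 * D / (v + s * D)) ω]
  · have hs0 : s ≠ 0 := norm_pos_iff.1 hspos
    rw [← sub_sub, add_sub_cancel_left, ← hs]
    field_simp
    ring

theorem dense_of_forall_exists_norm_lt {S : Set ℂ}
    (hmul : ∀ (x : GaussianInt), ∀ r ∈ S, (x : ℂ) * r ∈ S)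
    (hsmall : ∀ ε > 0, ∃ r ∈ S, r ≠ 0 ∧ ‖r‖ < ε) : Dense S := by
  refine fun v => Metric.mem_closure_iff.2 fun ε hε => ?_
  obtain ⟨r, hr, hr0, hrε⟩ := hsmall ε hε
  obtain ⟨x, hx⟩ := exists_sq_norm_sub_le (v / r)
  have hx1 : ‖v / r - x‖ ≤ 1 := (sq_le_one_iff₀ (norm_nonneg _)).1 (by linarith)
  refine ⟨x * r, hmul x r hr, ?_⟩
  calc dist v (x * r) = ‖v / r - x‖ * ‖r‖ := by
        rw [dist_eq_norm, ← norm_mul, sub_mul, div_mul_cancel₀ _ hr0]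
    _ ≤ ‖r‖ := mul_le_of_le_one_left (norm_nonneg _) hx1
    _ < ε := hrε

theorem three_le_norm_three : 3 ≤ ‖((3 : GaussianInt) : ℂ)‖ := by
  rw [map_ofNat, Complex.norm_ofNat]

theorem IsGeneric.exists_le_iterate (hf : IsNearestChoice f) {ζ : ℂ} (hζ : IsGeneric f ζ)
    (n : ℕ) : ∃ k z, n ≤ k ∧ iterate f ζ k = some z := by
  obtain ⟨k, hk⟩ := hζ.2 _ <| admissible_replicate_append hf (c := 3) (β := []) (z := 3)
    three_le_norm_three trivial (by norm_num) (n + 1)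
  rw [List.append_nil, List.replicate_succ', occursAt_append_iff, List.length_replicate] at hk
  obtain ⟨z, hz, -⟩ := hk.2.exists_iterate
  exact ⟨k + n, z, Nat.le_add_left n k, hz⟩

theorem dense_image_fst_conjugateLattice (hf : IsNearestChoice f) {ζ : ℂ} (ζ' : ℂ)
    (hζ : ∀ n, ∃ k z, n ≤ k ∧ iterate f ζ k = some z) :
    Dense (Prod.fst '' conjugateLattice ζ ζ') := by
  refine dense_of_forall_exists_norm_lt ?_ fun ε hε => ?_
  · rintro x _ ⟨u, hu, rfl⟩
    exact ⟨_, smul_add_smul_mem_conjugateLattice hu hu x 0, by simp⟩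
  · obtain ⟨n, hn⟩ := exists_pow_lt_of_lt_one hε (show (3 / 4 : ℝ) < 1 by norm_num)
    obtain ⟨k, z, hnk, hz⟩ := hζ n
    obtain ⟨u, v, huv, hu, -⟩ := IsAdaptedBasis.exists_of_iterate hf ζ ζ' hz
    exact ⟨u.1, ⟨u, huv.left_mem, rfl⟩, huv.fst_ne_zero,
      (hu.trans (pow_le_pow_of_le_one (by norm_num) (by norm_num) hnk)).trans_lt hn⟩

theorem dense_image_mul_conjugateLattice_self {ζ : ℂ}
    (h : Dense (Prod.fst '' conjugateLattice ζ ζ)) :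
    Dense ((fun p : ℂ × ℂ => p.1 * p.2) '' conjugateLattice ζ ζ) := by
  have hsq : Function.Surjective fun z : ℂ => z ^ 2 := fun v =>
    IsAlgClosed.exists_pow_nat_eq v two_pos
  refine (hsq.denseRange.dense_image (continuous_pow 2) h).mono ?_
  rintro _ ⟨_, ⟨_, ⟨p, rfl⟩, rfl⟩, rfl⟩
  exact ⟨_, ⟨p, rfl⟩, (sq _).symm⟩

theorem IsGeneric.dense_image_mul_conjugateLattice (hf : IsNearestChoice f) {ζ₁ : ℂ}
    (hζ : IsGeneric f ζ₁) (ζ₂ : ℂ) :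
    Dense ((fun p : ℂ × ℂ => p.1 * p.2) '' conjugateLattice ζ₁ ζ₂) := by
  rcases eq_or_ne ζ₁ ζ₂ with rfl | hne
  · exact dense_image_mul_conjugateLattice_self
      (dense_image_fst_conjugateLattice hf ζ₁ (hζ.exists_le_iterate hf))
  · intro v
    obtain ⟨ω, hω, hω1⟩ := exists_fixedPoint_norm_le_one (3 : GaussianInt)
    obtain ⟨x, t, ht, rfl⟩ := exists_nat_and_root_of_value (sub_ne_zero.2 hne) ω v
    simpa using hζ.mem_closure_image_mul hf ζ₂ three_le_norm_three hω hω1 ht x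

end Hurwitz

theorem corollary8p8 (f : ℂ → GaussianInt) (hf : Hurwitz.IsNearestChoice f) (ζ₁ ζ₂ : ℂ)
    (hζ : Hurwitz.IsGeneric f ζ₁ ∨ Hurwitz.IsGeneric f ζ₂) :
    Dense {w : ℂ | ∃ a b : GaussianInt,
      w = ((a : ℂ) - ζ₁ * (b : ℂ)) * ((a : ℂ) - ζ₂ * (b : ℂ))} := by
  rcases hζ with h | h
  · refine (h.dense_image_mul_conjugateLattice hf ζ₂).mono ?_
    rintro _ ⟨_, ⟨⟨a, b⟩, rfl⟩, rfl⟩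
    exact ⟨a, b, rfl⟩
  · refine (h.dense_image_mul_conjugateLattice hf ζ₁).mono ?_
    rintro _ ⟨_, ⟨⟨a, b⟩, rfl⟩, rfl⟩
    exact ⟨a, b, mul_comm _ _⟩
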